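/- Let $K$ be a field endowed with a rank-one valuation $v$ (a nontrivial valuation, written additively, with $v(K^*)$ a subgroup of $(\mathbb{R},+)$), let $V$ be its valuation domain, $\mathfrak{m}$ the maximal ideal of $V$, and let $E$ be a subset of $V$. Let $$\mathrm{Int}(E,V)=\{f\in K[X]\mid f(E)\subseteq V\}.$$ A sequence $(x_n)_{n\ge 0}$ of elements of $V$ is called pseudo-divergent if $v(x_n-x_m)<v(x_m-x_l)$ for all $n>m>l\ge 0$, and pseudo-stationary if its terms are pairwise distinct and $v(x_n-x_m)=v(x_m-x_l)$ for all $n>m>l\ge 0$. Assume that $E$ contains no pseudo-divergent sequence and no pseudo-stationary sequence. Then every prime ideal of $\mathrm{Int}(E,V)$ lies over $(0)$ or over $\mathfrak{m}$, and: 1. The map $$q\mapsto \mathfrak{P}_q=qK[X]\cap \mathrm{Int}(E,V)$$ is a bijection from the set of monic irreducible polynomials $q\in K[X]$ onto the set of nonzero prime ideals of $\mathrm{Int}(E,V)$ lying over the ideal $(0)$ of $V$. 2. Every prime ideal of $\mathrm{Int}(E,V)$ lying over $\mathfrak{m}$ is maximal, with residue field isomorphic (as a $V$-algebra) to $V/\mathfrak{m}$.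 The prime ideals of $\mathrm{Int}(E,V)$ lying over $\mathfrak{m}$ are exactly the ideals $$\mathfrak{m}_{\mathcal{U}}=\{f\in \mathrm{Int}(E,V)\mid \{x\in E\mid f(x)\in\mathfrak{m}\}\in\mathcal{U}\},$$ where $\mathcal{U}$ ranges over the ultrafilters on $E$. Consequently, if $E$ is nonempty, the Krull dimension of $\mathrm{Int}(E,V)$ is $2$. -/

import Mathlib

open scoped Polynomial

namespace IntegerValuedPolynomials

variable {K : Type*} [Field K] {Γ₀ : Type*} [LinearOrderedCommGroupWithZero Γ₀]

/-- A sequence of elements of the valuation ring `V` of `v` is pseudo-divergent if for all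
`n > m > l` the (additively written) valuation of `x n - x m` is smaller than that of `x m - x l`.
Mathlib's valuations are written multiplicatively, which reverses the inequality. -/
def IsPseudoDivergent (v : Valuation K Γ₀) (x : ℕ → v.valuationSubring) : Prop :=
  ∀ n m l : ℕ, l < m → m < n → v ((x m : K) - x l) < v ((x n : K) - x m)

/-- A sequence of (pairwise distinct) elements of the valuation ring `V` of `v` is
pseudo-stationary if for all `n > m > l` the valuations of `x n - x m` and `x m - x l` are equal.
The terms are required to be distinct: the equalities alone also hold for a constant sequence,
which does not count as pseudo-stationary. -/
def IsPseudoStationary (v : Valuation K Γ₀) (x : ℕ → v.valuationSubring) : Prop :=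
  Function.Injective x ∧
    ∀ n m l : ℕ, l < m → m < n → v ((x n : K) - x m) = v ((x m : K) - x l)

/-- `Int(E, V) = {f ∈ K[X] | f(E) ⊆ V}`, as a `V`-subalgebra of `K[X]`, where `V` is the valuation
ring of `v` and `E` is a subset of `V`. -/
noncomputable def intPoly (v : Valuation K Γ₀) (E : Set v.valuationSubring) :
    Subalgebra v.valuationSubring K[X] where
  carrier := {f | ∀ x ∈ E, f.eval (x : K) ∈ v.valuationSubring}
  mul_mem' := by
    intro f g hf hg x hx
    rw [Polynomial.eval_mul]
    exact mul_mem (hf x hx) (hg x hx)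
  add_mem' := by
    intro f g hf hg x hx
    rw [Polynomial.eval_add]
    exact add_mem (hf x hx) (hg x hx)
  algebraMap_mem' := by
    intro r x _
    rw [Polynomial.algebraMap_apply, Polynomial.eval_C]
    exact r.2

/-- The value `f(x) ∈ V` of `f ∈ Int(E, V)` at a point `x` of `E`, as a ring homomorphism in `f`. -/
noncomputable def evalAt (v : Valuation K Γ₀) (E : Set v.valuationSubring) (x : E) :
    intPoly v E →+* v.valuationSubring :=
  ((Polynomial.evalRingHom ((x : v.valuationSubring) : K)).comp
    (intPoly v E).val.toRingHom).codRestrict v.valuationSubring (fun f => f.2 x x.2)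

/-- The ideal `𝔓_q = qK[X] ∩ Int(E, V)` of `Int(E, V)`. -/
noncomputable def idealOfPoly (v : Valuation K Γ₀) (E : Set v.valuationSubring) (q : K[X]) :
    Ideal (intPoly v E) :=
  (Ideal.span {q}).comap (intPoly v E).val

/-- The ideal `𝔪_U = {f ∈ Int(E, V) | f⁻¹(𝔪) ∈ U}` of `Int(E, V)`, where `U` is an ultrafilter
on `E`. -/
noncomputable def idealOfUltrafilter (v : Valuation K Γ₀) (E : Set v.valuationSubring) (U : Ultrafilter E) :
    Ideal (intPoly v E) where
  carrier := {f | {x : E | evalAt v E x f ∈ IsLocalRing.maximalIdeal v.valuationSubring} ∈ U}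
  add_mem' := by
    intro f g hf hg
    refine Filter.mem_of_superset (Filter.inter_mem hf hg) ?_
    rintro x ⟨hx, hx'⟩
    simp only [Set.mem_ofPred_eq, map_add] at hx hx' ⊢
    exact Ideal.add_mem _ hx hx'
  zero_mem' := by
    refine Filter.mem_of_superset Filter.univ_mem ?_
    intro x _
    simp only [Set.mem_ofPred_eq, map_zero]
    exact Ideal.zero_mem _
  smul_mem' := by
    intro c f hf
    refine Filter.mem_of_superset hf ?_
    intro x hx
    simp only [Set.mem_ofPred_eq, smul_eq_mul, map_mul] at hx ⊢
    exact Ideal.mul_mem_left _ _ hx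

end IntegerValuedPolynomials

/-! Everything over `𝔪` rests on one fact: a sequence of distinct points of `E` has a
pseudo-convergent subsequence (`exists_pseudoConvergent_subseq`), and polynomials behave well along
such sequences. Kaplansky's method shows that their values eventually do not increase, and that
integral values are eventually congruent modulo `𝔪`.

Hence an `f` in `Int(E, V)` has finitely many residues on `E`, and if its values all lie in `𝔪` they
are bounded away from `1`. In the latter case rank one makes some power of `f` divisible in `Int(E,
V)` by a nonzero constant of `𝔪`, so `f` lies in every prime over `𝔪`. Applied to suitable finite
products, this yields both the residue field and the ultrafilter description.

Primes over `(0)` need nothing about `E`: inverting the nonzero constants turns `Int(E, V)` into the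
principal ideal domain `K[X]`. -/

namespace IntegerValuedPolynomials

open Filter

/-! ### Extraction of pseudo-convergent subsequences -/

section Sequences

variable {K : Type*} [Field K] {Γ₀ : Type*} [LinearOrderedCommGroupWithZero Γ₀]

/-- The sequence `x` is pseudo-convergent with gauge `γ`: the gauge is strictly decreasing
(multiplicatively) and `v (x n - x m) = γ m` for all `n > m`. -/
def IsPseudoConvergent (v : Valuation K Γ₀) (x : ℕ → K) (γ : ℕ → Γ₀) : Prop :=
  StrictAnti γ ∧ ∀ m n, m < n → v (x n - x m) = γ m

theorem isPseudoConvergent_of_strictAnti_dist {v : Valuation K Γ₀} {x : ℕ → K} {a : K}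
    (h : StrictAnti fun n => v (x n - a)) : IsPseudoConvergent v x fun n => v (x n - a) := by
  refine ⟨h, fun m n hmn => ?_⟩
  rw [← sub_sub_sub_cancel_right (x n) (x m) a]
  exact Valuation.map_sub_eq_of_lt_right v (h hmn)

theorem map_sub_eq_of_strictMono_dist {v : Valuation K Γ₀} {x : ℕ → K} {a : K}
    (h : StrictMono fun n => v (x n - a)) {m n : ℕ} (hmn : m < n) :
    v (x n - x m) = v (x n - a) := by
  rw [← sub_sub_sub_cancel_right (x n) (x m) a]
  exact Valuation.map_sub_eq_of_lt_left v (h hmn)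

/-- A sequence without repetitions and without pseudo-divergent or pseudo-stationary subsequences
has a pseudo-convergent subsequence. -/
theorem exists_pseudoConvergent_subseq {v : Valuation K Γ₀} {x : ℕ → v.valuationSubring}
    (hx : Function.Injective x)
    (hdiv : ∀ φ : ℕ → ℕ, ¬ IsPseudoDivergent v (x ∘ φ))
    (hstat : ∀ φ : ℕ → ℕ, ¬ IsPseudoStationary v (x ∘ φ)) :
    ∃ φ : ℕ → ℕ, StrictMono φ ∧ ∃ γ, IsPseudoConvergent v (fun n => (x (φ n) : K)) γ := by
  have hgt : ∀ m : ℕ, ∀ᶠ n in (hyperfilter ℕ : Filter ℕ), m < n := fun m =>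
    Nat.hyperfilter_le_atTop (eventually_gt_atTop m)
  -- If the distances to each `x m` stabilise along the ultrafilter, a subsequence has distances
  -- depending only on the earlier index, and Ramsey makes this gauge strictly monotone or constant.
  -- Otherwise distances to some `x a` can be made pairwise distinct, hence strictly monotone.
  by_cases hc : ∀ m, ∃ γ, ∀ᶠ n in (hyperfilter ℕ : Filter ℕ), v ((x n : K) - x m) = γ
  · choose γ hγ using hc
    obtain ⟨φ, -, hφ⟩ := exists_seq_of_forall_finset_exists (fun _ : ℕ => True)
      (fun m n => m < n ∧ v ((x n : K) - x m) = γ m) (fun s _ => by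
        obtain ⟨y, hy⟩ := ((eventually_all_finset s).2 fun m _ => (hgt m).and (hγ m)).exists
        exact ⟨y, trivial, hy⟩)
    have hφm : StrictMono φ := fun m n h => (hφ m n h).1
    obtain ⟨g, hg | hg⟩ := exists_increasing_or_nonincreasing_subseq (· < ·) (γ ∘ φ)
    · refine absurd ?_ (hdiv (φ ∘ g))
      intro n m l hlm hmn
      simp only [Function.comp_apply]
      rw [(hφ _ _ (g.strictMono hlm)).2, (hφ _ _ (g.strictMono hmn)).2]
      exact hg _ _ hlm
    obtain ⟨g', hg' | hg'⟩ := exists_increasing_or_nonincreasing_subseq (· > ·) (γ ∘ φ ∘ g)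
    · exact ⟨φ ∘ g ∘ g', hφm.comp (g.strictMono.comp g'.strictMono), γ ∘ φ ∘ g ∘ g',
        fun m n h => hg' m n h,
        fun m n h => (hφ _ _ (g.strictMono (g'.strictMono h))).2⟩
    · refine absurd ?_ (hstat (φ ∘ g ∘ g'))
      refine ⟨hx.comp (hφm.comp (g.strictMono.comp g'.strictMono)).injective, ?_⟩
      intro n m l hlm hmn
      simp only [Function.comp_apply]
      rw [(hφ _ _ (g.strictMono (g'.strictMono hlm))).2,
        (hφ _ _ (g.strictMono (g'.strictMono hmn))).2]
      exact le_antisymm (not_lt.1 (hg _ _ (g'.strictMono hlm))) (not_lt.1 (hg' _ _ hlm))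
  · push Not at hc
    obtain ⟨a, ha⟩ := hc
    obtain ⟨φ, -, hφ⟩ := exists_seq_of_forall_finset_exists (fun _ : ℕ => True)
      (fun m n => m < n ∧ v ((x n : K) - x a) ≠ v ((x m : K) - x a)) (fun s _ => by
        obtain ⟨y, hy⟩ := ((eventually_all_finset s).2 fun m _ => (hgt m).and (ha _)).exists
        exact ⟨y, trivial, hy⟩)
    have hφm : StrictMono φ := fun m n h => (hφ m n h).1
    obtain ⟨g, hg | hg⟩ := exists_increasing_or_nonincreasing_subseq (· < ·)
      fun n => v ((x (φ n) : K) - x a)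
    · refine absurd ?_ (hdiv (φ ∘ g))
      intro n m l hlm hmn
      have hmono : StrictMono fun n => v ((x (φ (g n)) : K) - x a) := fun m n h => hg m n h
      simp only [Function.comp_apply]
      rw [map_sub_eq_of_strictMono_dist hmono hlm, map_sub_eq_of_strictMono_dist hmono hmn]
      exact hg _ _ hmn
    · refine ⟨φ ∘ g, hφm.comp g.strictMono, _, isPseudoConvergent_of_strictAnti_dist (a := (x a : K)) ?_⟩
      exact fun m n h => lt_of_le_of_ne (not_lt.1 (hg m n h)) (hφ _ _ (g.strictMono h)).2

end Sequences

/-! ### Values of polynomials along pseudo-convergent sequences -/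

section Kaplansky

variable {K : Type*} [Field K] {Γ₀ : Type*} [LinearOrderedCommGroupWithZero Γ₀]

theorem ne_zero_of_strictAntiOn {T : ℕ → Γ₀} {N : ℕ} (hT : StrictAntiOn T (Set.Ici N)) {m : ℕ}
    (hm : N ≤ m) : T m ≠ 0 :=
  ((zero_le (a := T (m + 1))).trans_lt
    (hT hm (Set.mem_Ici.2 (hm.trans m.le_succ)) m.lt_succ_self)).ne'

/-- For `i < j`, a nonzero coincidence determines `T m ^ (j - i)` as `c i / c j`, which a strictly
decreasing `T` allows for at most one `m ≥ N`. -/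
theorem eventually_monomial_ne {T : ℕ → Γ₀} {N : ℕ} (hT : StrictAntiOn T (Set.Ici N))
    (s : Finset ℕ) (c : ℕ → Γ₀) :
    ∀ᶠ m in atTop, ∀ i ∈ s, ∀ j ∈ s, i ≠ j → c i * T m ^ i ≠ 0 →
      c i * T m ^ i ≠ c j * T m ^ j := by
  have key : ∀ i j, i < j → ∀ᶠ m in atTop, c i * T m ^ i ≠ 0 → c i * T m ^ i ≠ c j * T m ^ j := by
    intro i j hij
    by_cases hex : ∃ m, N ≤ m ∧ c i * T m ^ i ≠ 0 ∧ c i * T m ^ i = c j * T m ^ j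
    · obtain ⟨m, hm, h0, he⟩ := hex
      have hi : c i ≠ 0 := left_ne_zero_of_mul h0
      have hj : c j ≠ 0 := left_ne_zero_of_mul (he ▸ h0)
      have hpow : ∀ k, N ≤ k → c i * T k ^ i = c j * T k ^ j → T k ^ (j - i) = c i / c j := by
        intro k hk h
        have hk0 := ne_zero_of_strictAntiOn hT hk
        rw [eq_div_iff hj]
        apply mul_right_cancel₀ (pow_ne_zero i hk0)
        rw [h, mul_right_comm, ← pow_add, Nat.sub_add_cancel hij.le, mul_comm]
      filter_upwards [eventually_gt_atTop m] with k hk _ hk'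
      have h1 := hpow k (hm.trans hk.le) hk'
      rw [← hpow m hm he] at h1
      exact (pow_lt_pow_left₀ (hT hm (Set.mem_Ici.2 (hm.trans hk.le)) hk) zero_le
        (Nat.sub_ne_zero_of_lt hij)).ne h1
    · push Not at hex
      filter_upwards [eventually_ge_atTop N] with m hm h0
      exact hex m hm h0
  rw [eventually_all_finset]
  intro i _
  rw [eventually_all_finset]
  intro j _
  rcases lt_trichotomy i j with h | rfl | h
  · filter_upwards [key i j h] with m hm _
    exact hm
  · exact Eventually.of_forall fun _ h => absurd rfl h
  · filter_upwards [key j i h] with m hm _ h0 he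
    exact hm (he ▸ h0) he.symm

/-- A nonzero maximal value is attained once, so the ultrametric inequality is an equality. Using
`IsGreatest` leaves the dominant index unnamed, so it may later vary with `m`. -/
theorem isGreatest_map_sum (v : Valuation K Γ₀) {s : Finset ℕ} (hs : s.Nonempty) {t : ℕ → K}
    (h : ∀ i ∈ s, ∀ j ∈ s, i ≠ j → v (t i) ≠ 0 → v (t i) ≠ v (t j)) :
    IsGreatest ((fun i => v (t i)) '' s) (v (∑ i ∈ s, t i)) := by
  obtain ⟨i, hi, hmax⟩ := s.exists_max_image (fun i => v (t i)) hs
  have : v (∑ i ∈ s, t i) = v (t i) := by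
    by_cases h0 : v (t i) = 0
    · rw [h0]
      refine le_antisymm (v.map_sum_le fun j hj => ?_) zero_le
      exact (hmax j hj).trans h0.le
    · rw [← Finset.add_sum_erase s t hi]
      apply Valuation.map_add_eq_of_lt_left
      apply v.map_sum_lt h0
      intro j hj
      obtain ⟨hji, hj⟩ := Finset.mem_erase.1 hj
      exact lt_of_le_of_ne (hmax j hj) (h i hi j hj hji.symm h0).symm
  rw [this]
  exact ⟨⟨i, hi, rfl⟩, by rintro _ ⟨j, hj, rfl⟩; exact hmax j hj⟩

/-- A sum of terms whose values are `c i * T m ^ i`, with `T` eventually strictly decreasing,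
eventually has the value of its dominant term. -/
theorem eventually_isGreatest_map_sum (v : Valuation K Γ₀) {s : Finset ℕ} (hs : s.Nonempty)
    {T : ℕ → Γ₀} {N : ℕ} (hT : StrictAntiOn T (Set.Ici N)) (c : ℕ → Γ₀) :
    ∀ᶠ m in atTop, ∀ t : ℕ → K, (∀ i ∈ s, v (t i) = c i * T m ^ i) →
      IsGreatest ((fun i => c i * T m ^ i) '' s) (v (∑ i ∈ s, t i)) := by
  filter_upwards [eventually_monomial_ne hT s c] with m hm t ht
  have := isGreatest_map_sum v hs (t := t) (fun i hi j hj hij h0 => by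
    rw [ht i hi] at h0 ⊢
    rw [ht j hj]
    exact hm i hi j hj hij h0)
  rwa [Set.image_congr (fun i hi => ht i hi)] at this

/-- The value of the polynomial `f` is eventually constant along the sequence `x`. -/
def EventuallyConstValue (v : Valuation K Γ₀) (x : ℕ → K) (f : K[X]) : Prop :=
  ∃ c, ∀ᶠ n in atTop, v (f.eval (x n)) = c

theorem eval_sub_eval_eq_sum_hasseDeriv (f : K[X]) (a b : K) :
    f.eval b - f.eval a =
      ∑ i ∈ Finset.Icc 1 f.natDegree, (f.hasseDeriv i).eval a * (b - a) ^ i := by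
  have h : f.eval b = (f.taylor a).eval (b - a) := by rw [Polynomial.taylor_eval]; simp
  rw [h, Polynomial.eval_eq_sum_range, Polynomial.natDegree_taylor, Finset.sum_range_succ',
    Finset.range_eq_Ico, Finset.sum_Ico_add' (fun k => ((f.taylor a).coeff k) * (b - a) ^ k)]
  simp only [Polynomial.taylor_coeff, Polynomial.hasseDeriv_zero', pow_zero, mul_one,
    add_sub_cancel_right, zero_add]
  rfl

/-- Kaplansky: if the values of all higher Hasse derivatives of `f` are eventually constant along a
pseudo-convergent sequence, then its image under `f` is eventually pseudo-convergent. -/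
theorem IsPseudoConvergent.map_eval {v : Valuation K Γ₀} {x : ℕ → K} {γ : ℕ → Γ₀}
    (hx : IsPseudoConvergent v x γ) {f : K[X]} (hf : f.natDegree ≠ 0)
    (h : ∀ i, i ≠ 0 → EventuallyConstValue v x (f.hasseDeriv i)) :
    ∃ N, ∃ T : ℕ → Γ₀, StrictAntiOn T (Set.Ici N) ∧
      ∀ m n, N ≤ m → m < n → v (f.eval (x n) - f.eval (x m)) = T m := by
  have h' : ∀ i, ∃ c, i ≠ 0 → ∀ᶠ n in atTop, v ((f.hasseDeriv i).eval (x n)) = c := by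
    intro i
    by_cases hi : i = 0
    · exact ⟨0, fun h => absurd hi h⟩
    · exact (h i hi).imp fun c hc _ => hc
  choose c hc using h'
  have hs : (Finset.Icc 1 f.natDegree).Nonempty := ⟨1, by simp; omega⟩
  have hγ : StrictAntiOn γ (Set.Ici 0) := hx.1.strictAntiOn _
  have hev : ∀ᶠ m in atTop, ∀ i ∈ Finset.Icc 1 f.natDegree,
      v ((f.hasseDeriv i).eval (x m)) = c i :=
    (eventually_all_finset _).2 fun i hi => hc i (by simp at hi; omega)
  have hmain : ∀ᶠ m in atTop, ∀ n, m < n →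
      IsGreatest ((fun i => c i * γ m ^ i) '' (Finset.Icc 1 f.natDegree))
        (v (f.eval (x n) - f.eval (x m))) := by
    filter_upwards [hev, eventually_isGreatest_map_sum v hs hγ c] with m hm hm' n hmn
    rw [eval_sub_eval_eq_sum_hasseDeriv]
    apply hm'
    intro i hi
    rw [map_mul, map_pow, hm i hi, hx.2 m n hmn]
  obtain ⟨N, hN⟩ := eventually_atTop.1 hmain
  refine ⟨N, fun m => v (f.eval (x (m + 1)) - f.eval (x m)), ?_, ?_⟩
  · intro m hm n hn hmn
    have hgm := hN m hm (m + 1) m.lt_succ_self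
    obtain ⟨⟨i, hi, hie⟩, hup⟩ := hN n hn (n + 1) n.lt_succ_self
    -- The top Hasse derivative is the leading coefficient; this keeps the dominant term nonzero, as
    -- strict decrease requires.
    have hd0 : c f.natDegree ≠ 0 := by
      obtain ⟨k, hk⟩ := (hc f.natDegree hf).exists
      rw [← hk, Valuation.ne_zero_iff]
      have := Polynomial.hasseDeriv_natDegree_eq_C f
      rw [this, Polynomial.eval_C]
      rw [Polynomial.leadingCoeff_ne_zero]
      rintro rfl
      simp at hf
    have hpos : 0 < c i := by
      rw [zero_lt_iff]
      intro h0
      have h1 := hup ⟨f.natDegree, by simp; omega, rfl⟩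
      simp only [← hie, h0, zero_mul] at h1
      exact mul_ne_zero hd0 (pow_ne_zero _ (ne_zero_of_strictAntiOn hγ (Nat.zero_le n)))
        (le_antisymm h1 zero_le)
    have hi1 : i ≠ 0 := by simp at hi; omega
    change v _ < v _
    rw [← hie]
    refine lt_of_lt_of_le ?_ (hgm.2 ⟨i, hi, rfl⟩)
    exact mul_lt_mul_of_pos_left (pow_lt_pow_left₀ (hx.1 hmn) zero_le hi1) hpos
  · intro m n hm hmn
    exact (hN m hm n hmn).unique (hN m hm (m + 1) m.lt_succ_self)

/-- If `v (y m)` exceeded `T m`, every later `y n` would have the value of `y m`. So `v (y (m + 1))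
≤ T (m + 1) < T m`, and the difference `y (m + 1) - y m` can only get its value `T m` from `y m`. -/
theorem strictAntiOn_map_of_not_eventuallyConst {v : Valuation K Γ₀} {y : ℕ → K} {N : ℕ}
    {T : ℕ → Γ₀} (hT : StrictAntiOn T (Set.Ici N))
    (hy : ∀ m n, N ≤ m → m < n → v (y n - y m) = T m)
    (hc : ¬ ∃ c, ∀ᶠ n in atTop, v (y n) = c) : ∀ m, N ≤ m → v (y m) = T m := by
  have hle : ∀ m, N ≤ m → v (y m) ≤ T m := by
    intro m hm
    by_contra! hlt
    refine hc ⟨v (y m), ?_⟩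
    filter_upwards [eventually_gt_atTop m] with n hn
    have := Valuation.map_add_eq_of_lt_left v (x := y m) (y := y n - y m) (by rwa [hy m n hm hn])
    rwa [add_sub_cancel] at this
  intro m hm
  have h1 : v (y (m + 1)) < T m :=
    (hle _ (by omega)).trans_lt (hT hm (Set.mem_Ici.2 (by omega)) m.lt_succ_self)
  rw [← hy m (m + 1) hm m.lt_succ_self] at h1 ⊢
  have := Valuation.map_sub_eq_of_lt_right v h1
  rwa [sub_sub_cancel] at this

/-- Expansion of a polynomial in powers of `q`. -/
theorem exists_adic_expansion {q : K[X]} (hq : q.natDegree ≠ 0) (f : K[X]) :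
    ∃ a : ℕ → K[X], ∃ k, (∀ i, (a i).natDegree < q.natDegree) ∧
      f = ∑ i ∈ Finset.range (k + 1), a i * q ^ i := by
  induction hd : f.natDegree using Nat.strong_induction_on generalizing f with
  | _ d ih =>
    by_cases hlt : f.natDegree < q.natDegree
    · exact ⟨fun _ => f, 0, fun _ => hlt, by simp⟩
    · obtain ⟨a, k, ha, hf⟩ := ih (f / q).natDegree (by
        rw [← hd]
        have hf0 : f ≠ 0 := by rintro rfl; simp at hlt; omega
        by_cases h0 : f / q = 0
        · rw [h0, Polynomial.natDegree_zero]
          omega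
        · exact Polynomial.natDegree_lt_natDegree h0 (Polynomial.degree_div_lt hf0
            (Polynomial.natDegree_pos_iff_degree_pos.1 (Nat.pos_of_ne_zero hq)))) (f / q) rfl
      refine ⟨fun i => if i = 0 then f % q else a (i - 1), k + 1, ?_, ?_⟩
      · intro i
        dsimp only
        split_ifs
        · exact Polynomial.natDegree_mod_lt f hq
        · exact ha _
      · rw [Finset.sum_range_succ']
        conv_lhs => rw [← EuclideanDomain.div_add_mod f q, hf, Finset.mul_sum]
        simp only [Nat.succ_ne_zero, if_false, if_true, pow_zero, mul_one, Nat.add_sub_cancel]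
        congr 1
        exact Finset.sum_congr rfl fun i _ => by ring

/-- If some polynomial does not have eventually constant value along a pseudo-convergent sequence,
then a polynomial of least degree without this property has eventually strictly decreasing
values. -/
theorem IsPseudoConvergent.exists_minimal {v : Valuation K Γ₀} {x : ℕ → K} {γ : ℕ → Γ₀}
    (hx : IsPseudoConvergent v x γ) (hne : ∃ f, ¬ EventuallyConstValue v x f) :
    ∃ q : K[X], q.natDegree ≠ 0 ∧
      (∀ g : K[X], g.natDegree < q.natDegree → EventuallyConstValue v x g) ∧
      ∃ N, StrictAntiOn (fun n => v (q.eval (x n))) (Set.Ici N) := by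
  classical
  have hex : ∃ d, ∃ q : K[X], q.natDegree = d ∧ ¬ EventuallyConstValue v x q :=
    hne.elim fun f hf => ⟨_, f, rfl, hf⟩
  obtain ⟨q, hqd, hq⟩ := Nat.find_spec hex
  have hmin : ∀ g : K[X], g.natDegree < q.natDegree → EventuallyConstValue v x g := by
    intro g hg
    by_contra hg'
    exact Nat.find_min hex (hqd ▸ hg) ⟨g, rfl, hg'⟩
  have hq0 : q.natDegree ≠ 0 := by
    intro h0
    rw [Polynomial.natDegree_eq_zero] at h0
    obtain ⟨a, rfl⟩ := h0
    exact hq ⟨v a, by simp⟩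
  refine ⟨q, hq0, hmin, ?_⟩
  obtain ⟨N, T, hT, hTv⟩ := hx.map_eval hq0 (fun i hi => hmin _ (by
    have := Polynomial.natDegree_hasseDeriv_le q i
    omega))
  have := strictAntiOn_map_of_not_eventuallyConst hT hTv hq
  exact ⟨N, hT.congr fun m hm => (this m hm).symm⟩

/-- In the `q`-adic expansion the coefficients have eventually constant value by minimality of `q`,
while the values of `q` strictly decrease, so the dominant-term principle applies. -/
theorem eventually_isGreatest_adic {v : Valuation K Γ₀} {x : ℕ → K} {q : K[X]}
    (hmin : ∀ g : K[X], g.natDegree < q.natDegree → EventuallyConstValue v x g) {N : ℕ}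
    (hN : StrictAntiOn (fun n => v (q.eval (x n))) (Set.Ici N)) {a : ℕ → K[X]} {k : ℕ}
    (ha : ∀ i, (a i).natDegree < q.natDegree) :
    ∃ c : ℕ → Γ₀, ∀ᶠ m in atTop, (∀ i ∈ Finset.range (k + 1), v ((a i).eval (x m)) = c i) ∧
      IsGreatest ((fun i => c i * v (q.eval (x m)) ^ i) '' (Finset.range (k + 1)))
        (v ((∑ i ∈ Finset.range (k + 1), a i * q ^ i).eval (x m))) := by
  choose c hc using fun i => hmin (a i) (ha i)
  refine ⟨c, ?_⟩
  have hev : ∀ᶠ m in atTop, ∀ i ∈ Finset.range (k + 1), v ((a i).eval (x m)) = c i :=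
    (eventually_all_finset _).2 fun i _ => hc i
  filter_upwards [hev, eventually_isGreatest_map_sum v (s := Finset.range (k + 1))
    (by simp) hN c] with m hm hm'
  refine ⟨hm, ?_⟩
  rw [Polynomial.eval_finsetSum]
  apply hm'
  intro i hi
  rw [Polynomial.eval_mul, Polynomial.eval_pow, map_mul, map_pow, hm i hi]

/-- The values of a polynomial along a pseudo-convergent sequence are eventually
non-increasing. -/
theorem IsPseudoConvergent.eventually_antitone {v : Valuation K Γ₀} {x : ℕ → K} {γ : ℕ → Γ₀}
    (hx : IsPseudoConvergent v x γ) (f : K[X]) :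
    ∃ N, AntitoneOn (fun n => v (f.eval (x n))) (Set.Ici N) := by
  by_cases hne : ∃ f, ¬ EventuallyConstValue v x f
  · obtain ⟨q, hq0, hmin, N, hN⟩ := hx.exists_minimal hne
    obtain ⟨a, k, ha, rfl⟩ := exists_adic_expansion hq0 f
    obtain ⟨c, hc⟩ := eventually_isGreatest_adic (k := k) hmin hN ha
    obtain ⟨M, hM⟩ := eventually_atTop.1 (hc.and (eventually_ge_atTop N))
    refine ⟨M, fun m hm n hn hmn => ?_⟩
    -- The index dominant at the later `n` is compared with the same index at `m`.
    obtain ⟨i, hi, hie⟩ := (hM n hn).1.2.1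
    change v _ ≤ v _
    rw [← hie]
    refine le_trans ?_ ((hM m hm).1.2.2 ⟨i, hi, rfl⟩)
    exact mul_le_mul_right (pow_le_pow_left₀ zero_le
      (hN.antitoneOn (hM m hm).2 (hM n hn).2 hmn) i) _
  · push Not at hne
    obtain ⟨c, hc⟩ := hne f
    obtain ⟨N, hN⟩ := eventually_atTop.1 hc
    exact ⟨N, fun m hm n hn _ => by simp only [hN m hm, hN n hn, le_refl]⟩

/-- For nonconstant `f`, the gauge of the image sequence is at most `1`, being a value of
differences of integral elements; it strictly decreases, so it is below `1` one step later. -/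
theorem IsPseudoConvergent.eventually_map_sub_lt_one_of_hasseDeriv {v : Valuation K Γ₀} {x : ℕ → K}
    {γ : ℕ → Γ₀} (hx : IsPseudoConvergent v x γ) {f : K[X]}
    (h : ∀ i, i ≠ 0 → i ≤ f.natDegree → EventuallyConstValue v x (f.hasseDeriv i))
    (hf : ∀ᶠ n in atTop, v (f.eval (x n)) ≤ 1) :
    ∃ N, ∀ m n, N ≤ m → m < n → v (f.eval (x n) - f.eval (x m)) < 1 := by
  by_cases h0 : f.natDegree = 0
  · obtain ⟨a, rfl⟩ := Polynomial.natDegree_eq_zero.1 h0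
    exact ⟨0, by simp⟩
  · obtain ⟨N, T, hT, hTv⟩ := hx.map_eval h0 (fun i hi => by
      by_cases hif : i ≤ f.natDegree
      · exact h i hi hif
      · rw [Polynomial.hasseDeriv_eq_zero_of_lt_natDegree f i (not_le.1 hif)]
        exact ⟨0, by simp⟩)
    obtain ⟨M, hM⟩ := eventually_atTop.1 (hf.and (eventually_ge_atTop N))
    refine ⟨M + 1, fun m n hm hmn => ?_⟩
    have hNM : N ≤ M := (hM M le_rfl).2
    rw [hTv m n (by omega) hmn]
    calc T m < T M := hT hNM (Set.mem_Ici.2 (by omega)) (by omega)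
      _ = v (f.eval (x m) - f.eval (x M)) := (hTv M m hNM (by omega)).symm
      _ ≤ 1 := v.map_sub_le (hM m (by omega)).1 (hM M le_rfl).1

/-- If a polynomial is integral-valued on a pseudo-convergent sequence, then its values are
eventually congruent to each other modulo the maximal ideal. -/
theorem IsPseudoConvergent.eventually_map_sub_lt_one {v : Valuation K Γ₀} {x : ℕ → K}
    {γ : ℕ → Γ₀} (hx : IsPseudoConvergent v x γ) {f : K[X]}
    (hf : ∀ n, v (f.eval (x n)) ≤ 1) :
    ∃ N, ∀ m n, N ≤ m → m < n → v (f.eval (x n) - f.eval (x m)) < 1 := by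
  by_cases hne : ∃ f, ¬ EventuallyConstValue v x f
  · obtain ⟨q, hq0, hmin, N, hN⟩ := hx.exists_minimal hne
    obtain ⟨a, k, ha, rfl⟩ := exists_adic_expansion hq0 f
    obtain ⟨c, hc⟩ := eventually_isGreatest_adic (k := k) hmin hN ha
    obtain ⟨M, hM⟩ := eventually_atTop.1 (hc.and (eventually_ge_atTop N))
    have hterm : ∀ m, M ≤ m → ∀ i ∈ Finset.range (k + 1),
        c i * v (q.eval (x m)) ^ i ≤ 1 := fun m hm i hi =>
      ((hM m hm).1.2.2 ⟨i, hi, rfl⟩).trans (hf m)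
    have hhead : ∀ m, M ≤ m → v ((a 0).eval (x m)) ≤ 1 := by
      intro m hm
      have := hterm m hm 0 (by simp)
      rwa [pow_zero, mul_one, ← (hM m hm).1.1 0 (by simp)] at this
    -- Terms with a positive power of `q` are at most `1` at `M` and then strictly decrease or
    -- vanish. Only `a 0` can contribute to the residue, and its degree is below that of `q`.
    have htail : ∀ m, M < m → ∀ i ∈ Finset.range k,
        v ((a (i + 1)).eval (x m) * q.eval (x m) ^ (i + 1)) < 1 := by
      intro m hm i hi
      have hi' : i + 1 ∈ Finset.range (k + 1) := by simpa using hi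
      rw [map_mul, map_pow, (hM m hm.le).1.1 _ hi']
      by_cases hc0 : c (i + 1) = 0
      · simp [hc0]
      · refine lt_of_lt_of_le ?_ (hterm M le_rfl _ hi')
        exact mul_lt_mul_of_pos_left (pow_lt_pow_left₀
          (hN (hM M le_rfl).2 (hM m hm.le).2 hm) zero_le i.succ_ne_zero) (zero_lt_iff.2 hc0)
    obtain ⟨L, hL⟩ := hx.eventually_map_sub_lt_one_of_hasseDeriv (f := a 0)
      (fun i hi _ => hmin _ (by
        have := Polynomial.natDegree_hasseDeriv_le (a 0) i
        have := ha 0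
        omega))
      (eventually_atTop.2 ⟨M, hhead⟩)
    refine ⟨max L (M + 1), fun m n hm hmn => ?_⟩
    have hsum : ∀ j, (∑ i ∈ Finset.range (k + 1), a i * q ^ i).eval (x j) =
        (∑ i ∈ Finset.range k, (a (i + 1)).eval (x j) * q.eval (x j) ^ (i + 1)) +
          (a 0).eval (x j) := by
      intro j
      rw [Finset.sum_range_succ', Polynomial.eval_add, Polynomial.eval_finsetSum]
      simp
    rw [hsum, hsum, add_sub_add_comm]
    have hm1 : M < m := by omega
    exact v.map_add_lt (v.map_sub_lt (v.map_sum_lt one_ne_zero (htail n (by omega)))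
      (v.map_sum_lt one_ne_zero (htail m hm1))) (hL m n (by omega) hmn)
  · push Not at hne
    exact hx.eventually_map_sub_lt_one_of_hasseDeriv (fun i _ _ => hne _) (Eventually.of_forall hf)

end Kaplansky

/-! ### Consequences of rank one -/

section Valuation

variable {K : Type*} [Field K] {Γ₀ : Type*} [LinearOrderedCommGroupWithZero Γ₀]

/-- Every sequence of distinct elements of `E` has a pseudo-convergent subsequence. -/
def HasPseudoConvergentSubseq (v : Valuation K Γ₀) (E : Set v.valuationSubring) : Prop :=
  ∀ x : ℕ → v.valuationSubring, (∀ n, x n ∈ E) → Function.Injective x →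
    ∃ φ : ℕ → ℕ, StrictMono φ ∧ ∃ γ, IsPseudoConvergent v (fun n => (x (φ n) : K)) γ

theorem exists_pow_le (v : Valuation K Γ₀) [v.RankOne] {a b : K} (ha : a ≠ 0) (hb : v b < 1) :
    ∃ n : ℕ, v b ^ n ≤ v a := by
  have hmono := Valuation.RankOne.strictMono v
  have h1 : Valuation.RankOne.hom v (v.restrict b) < 1 := by
    rw [← map_one (Valuation.RankOne.hom v)]
    exact hmono (v.restrict_lt_one_iff.2 hb)
  have h0 : 0 < Valuation.RankOne.hom v (v.restrict a) := by
    rw [← map_zero (Valuation.RankOne.hom v)]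
    exact hmono (zero_lt_iff.2 ((Valuation.ne_zero_iff _).2 ha))
  obtain ⟨n, hn⟩ := exists_pow_lt_of_lt_one h0 h1
  refine ⟨n, ?_⟩
  rw [← map_pow, ← map_pow, hmono.lt_iff_lt, Valuation.restrict_lt_iff, map_pow] at hn
  exact hn.le

theorem exists_ne_zero_lt_one (v : Valuation K Γ₀) [v.RankOne] :
    ∃ s : K, s ≠ 0 ∧ v s < 1 := by
  obtain ⟨r, hr0, hr1⟩ := Valuation.RankOne.nontrivial v
  have hr : r ≠ 0 := v.ne_zero_iff.1 hr0
  rcases lt_or_gt_of_ne hr1 with h | h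
  · exact ⟨r, hr, h⟩
  · exact ⟨r⁻¹, inv_ne_zero hr, by rw [map_inv₀]; exact inv_lt_one_of_one_lt₀ h⟩

theorem maximalIdeal_ne_bot (v : Valuation K Γ₀) [v.RankOne] :
    IsLocalRing.maximalIdeal v.valuationSubring ≠ ⊥ := by
  obtain ⟨s, hs0, hs⟩ := exists_ne_zero_lt_one v
  intro h
  have : (⟨s, hs.le⟩ : v.valuationSubring) ∈ IsLocalRing.maximalIdeal v.valuationSubring :=
    v.mem_maximalIdeal_iff.2 hs
  rw [h, Ideal.mem_bot] at this
  exact hs0 (congrArg Subtype.val this)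

theorem eq_bot_or_eq_maximalIdeal (v : Valuation K Γ₀) [v.RankOne]
    (p : Ideal v.valuationSubring) (hp : p.IsPrime) :
    p = ⊥ ∨ p = IsLocalRing.maximalIdeal v.valuationSubring := by
  refine or_iff_not_imp_left.2 fun hne => ?_
  obtain ⟨a, ha, ha0⟩ := Submodule.exists_mem_ne_zero_of_ne_bot hne
  refine le_antisymm (IsLocalRing.le_maximalIdeal hp.ne_top) fun t ht => ?_
  have ha0' : (a : K) ≠ 0 := fun h => ha0 (Subtype.ext h)
  obtain ⟨n, hn⟩ := exists_pow_le v ha0' (v.mem_maximalIdeal_iff.1 ht)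
  refine hp.mem_of_pow_mem n ?_
  have hmem : (t : K) ^ n / a ∈ v.valuationSubring := by
    rw [Valuation.mem_valuationSubring_iff, map_div₀, map_pow]
    exact div_le_one_of_le₀ hn zero_le
  have : t ^ n = ⟨_, hmem⟩ * a := Subtype.ext (by simp [ha0'])
  rw [this]
  exact p.mul_mem_left _ ha

end Valuation

/-! ### Prime ideals over the maximal ideal -/

section IntPoly

variable {K : Type*} [Field K] {Γ₀ : Type*} [LinearOrderedCommGroupWithZero Γ₀]
variable {v : Valuation K Γ₀} {E : Set v.valuationSubring}

theorem coe_evalAt (x : E) (f : intPoly v E) :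
    (evalAt v E x f : K) = (f : K[X]).eval ((x : v.valuationSubring) : K) := rfl

theorem evalAt_algebraMap (x : E) (a : v.valuationSubring) :
    evalAt v E x (algebraMap _ (intPoly v E) a) = a :=
  Subtype.ext (by
    rw [coe_evalAt, Subalgebra.coe_algebraMap, Polynomial.algebraMap_apply, Polynomial.eval_C]
    rfl)

/-- An integer-valued polynomial has finitely many residues on a set in which sequences have
pseudo-convergent subsequences. -/
theorem HasPseudoConvergentSubseq.finite_range_residue (hE : HasPseudoConvergentSubseq v E)
    (f : intPoly v E) :
    (Set.range fun x : E => IsLocalRing.residue v.valuationSubring (evalAt v E x f)).Finite := by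
  by_contra hinf
  have hinf : (Set.range fun x : E =>
    IsLocalRing.residue v.valuationSubring (evalAt v E x f)).Infinite := hinf
  -- Picks points with pairwise distinct residues, which eventual congruence along a subsequence
  -- will contradict.
  let e := hinf.natEmbedding
  choose x hx using fun n => (e n).2
  have hinj : Function.Injective fun n => evalAt v E (x n) f := by
    intro m n h
    refine e.injective (Subtype.ext ?_)
    rw [← hx m, ← hx n]
    exact congrArg _ h
  obtain ⟨φ, hφ, γ, hγ⟩ := hE (fun n => x n) (fun n => (x n).2) (fun m n h =>
    hinj (congrArg (fun y => evalAt v E y f) (Subtype.ext h)))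
  obtain ⟨N, hN⟩ := hγ.eventually_map_sub_lt_one (f := (f : K[X])) (fun n => f.2 _ (x (φ n)).2)
  have hlt := hN N (N + 1) le_rfl N.lt_succ_self
  have hmem : evalAt v E (x (φ (N + 1))) f - evalAt v E (x (φ N)) f ∈
      IsLocalRing.maximalIdeal v.valuationSubring := v.mem_maximalIdeal_iff.2 hlt
  have heq := Ideal.Quotient.eq.2 hmem
  have := e.injective (Subtype.ext ((hx _).symm.trans (heq.trans (hx _))))
  exact absurd (hφ.injective this) (by omega)

/-- If the values of `f` on `E` are in the maximal ideal, they are bounded away from `1`. -/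
theorem HasPseudoConvergentSubseq.exists_bound [v.RankOne] (hE : HasPseudoConvergentSubseq v E)
    {f : intPoly v E}
    (hf : ∀ x : E, evalAt v E x f ∈ IsLocalRing.maximalIdeal v.valuationSubring) :
    ∃ t : K, t ≠ 0 ∧ v t < 1 ∧ ∀ x : E, v (evalAt v E x f : K) ≤ v t := by
  obtain ⟨s, hs0, hs⟩ := exists_ne_zero_lt_one v
  by_contra! hcon
  -- The value at `x` is itself a candidate bound, or `s` if that value is zero. Iterating gives
  -- strictly increasing values, impossible along a pseudo-convergent subsequence.
  have hstep : ∀ x : E, ∃ y : E, v (evalAt v E x f : K) < v (evalAt v E y f : K) := by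
    intro x
    by_cases h0 : (evalAt v E x f : K) = 0
    · obtain ⟨y, hy⟩ := hcon s hs0 hs
      exact ⟨y, by rw [h0, map_zero]; exact zero_le.trans_lt hy⟩
    · exact hcon _ h0 (v.mem_maximalIdeal_iff.1 (hf x))
  choose g hg using hstep
  obtain ⟨x₀, -⟩ := hcon s hs0 hs
  let x : ℕ → E := fun n => g^[n] x₀
  have hmono : StrictMono fun n => v (evalAt v E (x n) f : K) := by
    refine strictMono_nat_of_lt_succ fun n => ?_
    change _ < v (evalAt v E (g^[n + 1] x₀) f : K)
    rw [Function.iterate_succ_apply']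
    exact hg _
  obtain ⟨φ, hφ, γ, hγ⟩ := hE (fun n => x n) (fun n => (x n).2) (fun m n h =>
    hmono.injective (congrArg (fun y => v (evalAt v E y f : K)) (Subtype.ext h)))
  obtain ⟨N, hN⟩ := hγ.eventually_antitone (f : K[X])
  exact (hN (Set.mem_Ici.2 le_rfl) (Set.mem_Ici.2 N.le_succ) N.le_succ).not_gt
    (hmono (hφ N.lt_succ_self))

/-- A polynomial with values in the maximal ideal lies in every prime over the maximal ideal. -/
theorem HasPseudoConvergentSubseq.mem_of_forall_evalAt_mem [v.RankOne]
    (hE : HasPseudoConvergentSubseq v E) {P : Ideal (intPoly v E)} (hP : P.IsPrime)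
    (hPm : P.under v.valuationSubring = IsLocalRing.maximalIdeal v.valuationSubring)
    {f : intPoly v E}
    (hf : ∀ x : E, evalAt v E x f ∈ IsLocalRing.maximalIdeal v.valuationSubring) : f ∈ P := by
  obtain ⟨t, ht0, ht, hle⟩ := hE.exists_bound hf
  obtain ⟨s, hs0, hs⟩ := exists_ne_zero_lt_one v
  obtain ⟨n, hn⟩ := exists_pow_le v hs0 ht
  -- The uniform bound `v t` makes a single exponent `n` work at all points of `E`.
  have hg : Polynomial.C s⁻¹ * (f : K[X]) ^ n ∈ intPoly v E := by
    intro x hx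
    rw [Polynomial.eval_mul, Polynomial.eval_C, Polynomial.eval_pow,
      Valuation.mem_valuationSubring_iff, map_mul, map_inv₀, map_pow, mul_comm, ← div_eq_mul_inv]
    exact div_le_one_of_le₀ ((pow_le_pow_left₀ zero_le (hle ⟨x, hx⟩) n).trans hn) zero_le
  let s' : v.valuationSubring := ⟨s, hs.le⟩
  have hs' : algebraMap _ (intPoly v E) s' ∈ P := by
    rw [← Ideal.mem_comap]
    change s' ∈ P.under _
    rw [hPm]
    exact v.mem_maximalIdeal_iff.2 hs
  refine hP.mem_of_pow_mem n ?_
  have : f ^ n = algebraMap _ (intPoly v E) s' * ⟨_, hg⟩ := by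
    refine Subtype.ext ?_
    change (f : K[X]) ^ n = Polynomial.C s * (Polynomial.C s⁻¹ * (f : K[X]) ^ n)
    rw [← mul_assoc, ← Polynomial.C_mul, mul_inv_cancel₀ hs0, Polynomial.C_1, one_mul]
  rw [this]
  exact P.mul_mem_right _ hs'

/-- With `r a` lifting the finitely many residues of `f`, the product of the `f - r a` has all its
values in `𝔪`, so it lies in `P`, and some factor does too. -/
theorem HasPseudoConvergentSubseq.algebraMap_quotient_surjective [v.RankOne]
    (hE : HasPseudoConvergentSubseq v E) {P : Ideal (intPoly v E)} (hP : P.IsPrime)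
    (hPm : P.under v.valuationSubring = IsLocalRing.maximalIdeal v.valuationSubring) :
    Function.Surjective (algebraMap v.valuationSubring (intPoly v E ⧸ P)) := by
  intro y
  obtain ⟨f, rfl⟩ := Ideal.Quotient.mk_surjective y
  choose r hr using IsLocalRing.residue_surjective (R := v.valuationSubring)
  have hprod : ∏ a ∈ (hE.finite_range_residue f).toFinset, (f - algebraMap _ _ (r a)) ∈ P := by
    refine hE.mem_of_forall_evalAt_mem hP hPm fun x => ?_
    rw [map_prod]
    refine Ideal.mem_of_dvd _ (Finset.dvd_prod_of_mem _
      ((Set.Finite.mem_toFinset _).2 ⟨x, rfl⟩)) ?_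
    rw [map_sub, evalAt_algebraMap, ← IsLocalRing.residue_eq_zero_iff, map_sub, hr, sub_self]
  obtain ⟨a, -, ha⟩ := (hP.prod_mem_iff).1 hprod
  exact ⟨r a, (Ideal.Quotient.eq.2 ha).symm⟩

/-- The residue field of a prime over the maximal ideal. -/
noncomputable def HasPseudoConvergentSubseq.quotientEquiv [v.RankOne]
    (hE : HasPseudoConvergentSubseq v E) {P : Ideal (intPoly v E)} (hP : P.IsPrime)
    (hPm : P.under v.valuationSubring = IsLocalRing.maximalIdeal v.valuationSubring) :
    (intPoly v E ⧸ P) ≃ₐ[v.valuationSubring]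
      (v.valuationSubring ⧸ IsLocalRing.maximalIdeal v.valuationSubring) :=
  ((Ideal.quotientEquivAlgOfEq v.valuationSubring (hPm.symm.trans (by
    ext a
    exact (Ideal.Quotient.eq_zero_iff_mem (I := P)).symm))).trans
    (Ideal.quotientKerAlgEquivOfSurjective (f := Algebra.ofId v.valuationSubring (intPoly v E ⧸ P))
      (hE.algebraMap_quotient_surjective hP hPm))).symm

theorem HasPseudoConvergentSubseq.isMaximal [v.RankOne]
    (hE : HasPseudoConvergentSubseq v E) {P : Ideal (intPoly v E)} (hP : P.IsPrime)
    (hPm : P.under v.valuationSubring = IsLocalRing.maximalIdeal v.valuationSubring) :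
    P.IsMaximal := by
  refine Ideal.Quotient.maximal_of_isField _ ?_
  refine (hE.quotientEquiv hP hPm).toMulEquiv.isField ?_
  exact (Ideal.Quotient.maximal_ideal_iff_isField_quotient _).1 inferInstance

theorem mem_idealOfUltrafilter {U : Ultrafilter E} {f : intPoly v E} :
    f ∈ idealOfUltrafilter v E U ↔
      {x : E | evalAt v E x f ∈ IsLocalRing.maximalIdeal v.valuationSubring} ∈ U := Iff.rfl

theorem isPrime_idealOfUltrafilter (U : Ultrafilter E) : (idealOfUltrafilter v E U).IsPrime := by
  refine ⟨fun h => ?_, fun {f g} h => ?_⟩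
  · rw [Ideal.eq_top_iff_one, mem_idealOfUltrafilter] at h
    obtain ⟨x, hx⟩ := U.neBot.nonempty_of_mem h
    rw [Set.mem_ofPred_eq, map_one] at hx
    exact (Ideal.ne_top_iff_one _).1 (IsLocalRing.maximalIdeal.isMaximal _).ne_top hx
  · simp only [mem_idealOfUltrafilter] at h ⊢
    rw [← Ultrafilter.union_mem_iff]
    refine mem_of_superset h fun x hx => ?_
    rw [Set.mem_ofPred_eq, map_mul] at hx
    exact (IsLocalRing.maximalIdeal.isMaximal v.valuationSubring).isPrime.mem_or_mem hx

theorem under_idealOfUltrafilter (U : Ultrafilter E) :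
    (idealOfUltrafilter v E U).under v.valuationSubring =
      IsLocalRing.maximalIdeal v.valuationSubring := by
  ext a
  rw [Ideal.under_def, Ideal.mem_comap, mem_idealOfUltrafilter]
  simp only [evalAt_algebraMap]
  by_cases ha : a ∈ IsLocalRing.maximalIdeal v.valuationSubring
  · simp only [ha, iff_true]
    exact univ_mem
  · simp only [ha, iff_false]
    exact U.empty_notMem

/-- The sets where some `h ∉ P` is a unit have the finite intersection property: otherwise a product
of elements outside `P` would have all its values in `𝔪` and lie in `P`. An ultrafilter containing
them gives `𝔪_U ≤ P`, and `𝔪_U` is maximal. -/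
theorem HasPseudoConvergentSubseq.exists_eq_idealOfUltrafilter [v.RankOne]
    (hE : HasPseudoConvergentSubseq v E) {P : Ideal (intPoly v E)} (hP : P.IsPrime)
    (hPm : P.under v.valuationSubring = IsLocalRing.maximalIdeal v.valuationSubring) :
    ∃ U : Ultrafilter E, P = idealOfUltrafilter v E U := by
  let Z : intPoly v E → Set E := fun h =>
    {x | evalAt v E x h ∉ IsLocalRing.maximalIdeal v.valuationSubring}
  obtain ⟨U, hU⟩ := Ultrafilter.exists_ultrafilter_of_finite_inter_nonempty (Z '' {h | h ∉ P}) (by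
    intro T hT
    obtain ⟨s, hs, rfl⟩ := Finset.subset_set_image_iff.1 hT
    have hprod : ∏ h ∈ s, h ∉ P := fun hmem => by
      obtain ⟨h, hhs, hh⟩ := hP.prod_mem_iff.1 hmem
      exact hs hhs hh
    by_contra hemp
    refine hprod (hE.mem_of_forall_evalAt_mem hP hPm fun x => ?_)
    by_contra hx
    refine hemp ⟨x, ?_⟩
    rw [Finset.coe_image]
    rintro _ ⟨h, hh, rfl⟩ hxh
    refine hx ?_
    rw [map_prod]
    exact Ideal.mem_of_dvd _ (Finset.dvd_prod_of_mem _ hh) hxh)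
  refine ⟨U, ((hE.isMaximal (isPrime_idealOfUltrafilter U)
    (under_idealOfUltrafilter U)).eq_of_le hP.ne_top fun f hf => ?_).symm⟩
  by_contra hfP
  have h1 : Z f ∈ U := hU ⟨f, hfP, rfl⟩
  exact U.compl_notMem_iff.2 (mem_idealOfUltrafilter.1 hf) h1

/-! ### Prime ideals over zero -/

theorem isLocalization_intPoly (v : Valuation K Γ₀) (E : Set v.valuationSubring) :
    IsLocalization (Algebra.algebraMapSubmonoid (intPoly v E) (nonZeroDivisors v.valuationSubring))
      K[X] where
  map_units := by
    rintro ⟨_, c, hc, rfl⟩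
    change IsUnit (Polynomial.C (c : K))
    have : (c : K) ≠ 0 := fun h => nonZeroDivisors.ne_zero hc (Subtype.ext h)
    exact Polynomial.isUnit_C.2 this.isUnit
  surj f := by
    obtain ⟨b, hb, h⟩ := IsLocalization.integerNormalization_spec
      (nonZeroDivisors v.valuationSubring) f
    -- Clearing denominators lands in `V[X]`, which is integer-valued because `E` lies in `V`.
    have hmem : f * Polynomial.C (b : K) ∈ intPoly v E := by
      intro x _
      have hbf : f * Polynomial.C (b : K) = b • f := by
        rw [mul_comm, ← Polynomial.smul_eq_C_mul]
        rfl
      rw [hbf, ← h]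
      change Polynomial.eval (algebraMap v.valuationSubring K x) _ ∈ _
      rw [Polynomial.eval_map_algebraMap, Polynomial.aeval_algebraMap_apply]
      exact Subtype.prop _
    exact ⟨⟨⟨_, hmem⟩, ⟨_, b, hb, rfl⟩⟩, rfl⟩
  exists_of_eq {f g} h := ⟨1, by rw [Subtype.ext h]⟩

theorem mem_idealOfPoly {q : K[X]} {f : intPoly v E} : f ∈ idealOfPoly v E q ↔ q ∣ (f : K[X]) :=
  Ideal.mem_span_singleton

theorem exists_smul_mem_intPoly (E : Set v.valuationSubring) (f : K[X]) :
    ∃ (c : v.valuationSubring) (g : intPoly v E), c ≠ 0 ∧ (g : K[X]) = f * Polynomial.C (c : K) := by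
  have := isLocalization_intPoly v E
  obtain ⟨⟨g, ⟨_, c, hc, rfl⟩⟩, h⟩ := IsLocalization.surj
    (Algebra.algebraMapSubmonoid (intPoly v E) (nonZeroDivisors v.valuationSubring)) f
  exact ⟨c, g, nonZeroDivisors.ne_zero hc, h.symm⟩

theorem isPrime_idealOfPoly {q : K[X]} (hq : Irreducible q) : (idealOfPoly v E q).IsPrime := by
  have : (Ideal.span {q}).IsPrime := (Ideal.span_singleton_prime hq.ne_zero).2 hq.prime
  exact Ideal.comap_isPrime _ _

theorem idealOfPoly_ne_bot {q : K[X]} (hq : Irreducible q) : idealOfPoly v E q ≠ ⊥ := by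
  obtain ⟨c, g, hc, hg⟩ := exists_smul_mem_intPoly E q
  intro h
  have hmem : g ∈ idealOfPoly v E q := mem_idealOfPoly.2 (hg ▸ dvd_mul_right _ _)
  rw [h, Ideal.mem_bot] at hmem
  rw [hmem] at hg
  have hc' : (c : K) ≠ 0 := fun h => hc (Subtype.ext h)
  exact mul_ne_zero hq.ne_zero (Polynomial.C_ne_zero.2 hc') hg.symm

theorem under_idealOfPoly {q : K[X]} (hq : Irreducible q) :
    (idealOfPoly v E q).under v.valuationSubring = ⊥ := by
  rw [eq_bot_iff]
  intro a ha
  have hdvd : q ∣ Polynomial.C (a : K) := mem_idealOfPoly.1 ha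
  by_contra ha0
  have ha' : (a : K) ≠ 0 := fun h => ha0 (Subtype.ext h)
  exact hq.not_isUnit (isUnit_of_dvd_unit hdvd (Polynomial.isUnit_C.2 ha'.isUnit))

theorem eq_of_idealOfPoly_le {p q : K[X]} (hp : p.Monic) (hp' : Irreducible p) (hq : q.Monic)
    (hq' : Irreducible q) (h : idealOfPoly v E p ≤ idealOfPoly v E q) : p = q := by
  obtain ⟨c, g, hc, hg⟩ := exists_smul_mem_intPoly E p
  have hmem : g ∈ idealOfPoly v E p := mem_idealOfPoly.2 (hg ▸ dvd_mul_right _ _)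
  have hdvd := mem_idealOfPoly.1 (h hmem)
  have hc' : (c : K) ≠ 0 := fun h => hc (Subtype.ext h)
  rw [hg, (Polynomial.isUnit_C.2 hc'.isUnit).dvd_mul_right] at hdvd
  exact (Polynomial.eq_of_monic_of_associated hq hp (hq'.associated_of_dvd hp' hdvd)).symm

/-- Such a `P` avoids the nonzero constants, so it is the contraction of its extension, a prime of
the principal ideal domain `K[X]`. -/
theorem exists_eq_idealOfPoly {P : Ideal (intPoly v E)} (hP : P.IsPrime) (hne : P ≠ ⊥)
    (hP0 : P.under v.valuationSubring = ⊥) :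
    ∃ q : K[X], (q.Monic ∧ Irreducible q) ∧ idealOfPoly v E q = P := by
  classical
  have := isLocalization_intPoly v E
  set M := Algebra.algebraMapSubmonoid (intPoly v E) (nonZeroDivisors v.valuationSubring)
  have hd : Disjoint (M : Set (intPoly v E)) P := by
    rw [Set.disjoint_left]
    rintro _ ⟨c, hc, rfl⟩ hcP
    have : c ∈ P.under v.valuationSubring := hcP
    rw [hP0, Ideal.mem_bot] at this
    exact nonZeroDivisors.ne_zero hc this
  have hQ := IsLocalization.isPrime_of_isPrime_disjoint M K[X] P hP hd
  have hQP := IsLocalization.under_map_of_isPrime_disjoint M K[X] hP hd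
  set Q := P.map (algebraMap (intPoly v E) K[X])
  obtain ⟨q₀, hq₀⟩ : ∃ q, Q = Ideal.span {q} := (IsPrincipalIdealRing.principal Q).principal
  have hq0 : q₀ ≠ 0 := by
    rintro rfl
    apply hne
    rw [← hQP, hq₀, eq_bot_iff]
    intro f hf
    have : (f : K[X]) ∈ Ideal.span {(0 : K[X])} := hf
    rw [Ideal.mem_span_singleton, zero_dvd_iff] at this
    exact Subtype.ext this
  have hspan : Ideal.span {normalize q₀} = Q := by
    rw [hq₀]
    exact Ideal.span_singleton_eq_span_singleton.2 (normalize_associated q₀)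
  refine ⟨normalize q₀, ⟨Polynomial.monic_normalize hq0, ?_⟩, ?_⟩
  · rw [← hspan, Ideal.span_singleton_prime (normalize_eq_zero.not.2 hq0)] at hQ
    exact hQ.irreducible
  · rw [← hQP, ← hspan]
    rfl

theorem bijOn_idealOfPoly (v : Valuation K Γ₀) (E : Set v.valuationSubring) :
    Set.BijOn (fun q : K[X] => idealOfPoly v E q) {q : K[X] | q.Monic ∧ Irreducible q}
      {P : Ideal (intPoly v E) | P.IsPrime ∧ P ≠ ⊥ ∧ P.under v.valuationSubring = ⊥} :=
  ⟨fun _ hq => ⟨isPrime_idealOfPoly hq.2, idealOfPoly_ne_bot hq.2, under_idealOfPoly hq.2⟩,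
    fun _ hp _ hq h => eq_of_idealOfPoly_le hp.1 hp.2 hq.1 hq.2 h.le,
    fun _ hP => exists_eq_idealOfPoly hP.1 hP.2.1 hP.2.2⟩

/-! ### Krull dimension -/

theorem HasPseudoConvergentSubseq.ringKrullDim_le [v.RankOne]
    (hE : HasPseudoConvergentSubseq v E) : ringKrullDim (intPoly v E) ≤ 2 := by
  refine iSup_le fun s => ?_
  by_contra! hlt
  have hlen : 3 ≤ s.length := by
    have : ((2 : ℕ) : WithBot ℕ∞) < (s.length : WithBot ℕ∞) := hlt
    exact_mod_cast this
  let p : Fin 4 → PrimeSpectrum (intPoly v E) := fun i => s ⟨i, by omega⟩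
  have hp : ∀ i j : Fin 4, i < j → (p i).asIdeal < (p j).asIdeal := fun i j hij =>
    s.strictMono (by simpa using hij)
  -- Primes over `𝔪` are maximal, so only the last can be one. The middle two are then nonzero
  -- primes over `(0)`, and comparable ones coincide.
  have hzero : ∀ i : Fin 4, i < 3 → (p i).asIdeal.under v.valuationSubring = ⊥ := by
    intro i hi
    refine (eq_bot_or_eq_maximalIdeal v _ ((p i).isPrime.under _)).resolve_right fun h => ?_
    exact (p 3).isPrime.ne_top ((hE.isMaximal (p i).isPrime h).out.2 _ (hp i 3 hi))
  obtain ⟨q, hq, hqe⟩ := exists_eq_idealOfPoly (p 1).isPrime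
    (bot_le.trans_lt (hp 0 1 (by decide))).ne' (hzero 1 (by decide))
  obtain ⟨q', hq', hqe'⟩ := exists_eq_idealOfPoly (p 2).isPrime
    (bot_le.trans_lt (hp 0 2 (by decide))).ne' (hzero 2 (by decide))
  have h12 := hp 1 2 (by decide)
  rw [← hqe, ← hqe'] at h12
  exact h12.ne (by rw [eq_of_idealOfPoly_le hq.1 hq.2 hq'.1 hq'.2 h12.le])

theorem two_le_ringKrullDim [v.RankOne] (hne : E.Nonempty) :
    2 ≤ ringKrullDim (intPoly v E) := by
  obtain ⟨x, hx⟩ := hne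
  have hirr := Polynomial.irreducible_X_sub_C (x : K)
  let p₀ : PrimeSpectrum (intPoly v E) := ⟨⊥, Ideal.isPrime_bot⟩
  let p₁ : PrimeSpectrum (intPoly v E) := ⟨_, isPrime_idealOfPoly hirr⟩
  -- The principal ultrafilter at `x` tests `f(x) ∈ 𝔪`, which multiples of `X - x` pass.
  let U : Ultrafilter E := pure ⟨x, hx⟩
  let p₂ : PrimeSpectrum (intPoly v E) := ⟨_, isPrime_idealOfUltrafilter U⟩
  have h01 : p₀ < p₁ := bot_lt_iff_ne_bot (α := Ideal (intPoly v E)).2 (idealOfPoly_ne_bot hirr)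
  have hle : idealOfPoly v E (Polynomial.X - Polynomial.C (x : K)) ≤ idealOfUltrafilter v E U := by
    intro f hf
    rw [mem_idealOfPoly, Polynomial.dvd_iff_isRoot] at hf
    have h0 : evalAt v E ⟨x, hx⟩ f = 0 := Subtype.ext hf
    refine mem_idealOfUltrafilter.2 (Ultrafilter.mem_pure.2 ?_)
    rw [Set.mem_ofPred_eq, h0]
    exact Ideal.zero_mem _
  have h12 : p₁ < p₂ := by
    refine lt_of_le_of_ne hle fun h => maximalIdeal_ne_bot v ?_
    rw [← under_idealOfUltrafilter U, ← under_idealOfPoly (E := E) hirr]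
    exact congrArg (fun p => p.asIdeal.under v.valuationSubring) h.symm
  let s : LTSeries (PrimeSpectrum (intPoly v E)) :=
    { length := 2
      toFun := ![p₀, p₁, p₂]
      step := fun i => by
        fin_cases i
        · exact h01
        · exact h12 }
  exact Order.LTSeries.length_le_krullDim s

end IntPoly

end IntegerValuedPolynomials

theorem mainTheorem3 {K : Type*} [Field K] {Γ₀ : Type*} [LinearOrderedCommGroupWithZero Γ₀]
    (v : Valuation K Γ₀) [v.RankOne] (E : Set v.valuationSubring)
    (hdiv : ¬ ∃ x : ℕ → v.valuationSubring,
      (∀ n, x n ∈ E) ∧ IntegerValuedPolynomials.IsPseudoDivergent v x)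
    (hstat : ¬ ∃ x : ℕ → v.valuationSubring,
      (∀ n, x n ∈ E) ∧ IntegerValuedPolynomials.IsPseudoStationary v x) :
    -- every prime ideal lies over `(0)` or over `𝔪`
    (∀ P : Ideal (IntegerValuedPolynomials.intPoly v E), P.IsPrime →
      P.under v.valuationSubring = ⊥ ∨
      P.under v.valuationSubring = IsLocalRing.maximalIdeal v.valuationSubring) ∧
    -- `q ↦ 𝔓_q` is a one-to-one correspondence from the monic irreducible polynomials of `K[X]`
    -- onto the nonzero primes lying over `(0)`
    Set.BijOn (fun q : K[X] => IntegerValuedPolynomials.idealOfPoly v E q)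
      {q : K[X] | q.Monic ∧ Irreducible q}
      {P : Ideal (IntegerValuedPolynomials.intPoly v E) |
        P.IsPrime ∧ P ≠ ⊥ ∧ P.under v.valuationSubring = ⊥} ∧
    -- the primes lying over `𝔪` are maximal, with residue field `V ⧸ 𝔪`
    (∀ P : Ideal (IntegerValuedPolynomials.intPoly v E), P.IsPrime →
      P.under v.valuationSubring = IsLocalRing.maximalIdeal v.valuationSubring →
      P.IsMaximal ∧
        Nonempty ((IntegerValuedPolynomials.intPoly v E ⧸ P) ≃ₐ[v.valuationSubring]
          (v.valuationSubring ⧸ IsLocalRing.maximalIdeal v.valuationSubring))) ∧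
    -- the primes lying over `𝔪` are exactly the ideals `𝔪_U`
    (∀ P : Ideal (IntegerValuedPolynomials.intPoly v E),
      (P.IsPrime ∧
        P.under v.valuationSubring = IsLocalRing.maximalIdeal v.valuationSubring) ↔
      ∃ U : Ultrafilter E, P = IntegerValuedPolynomials.idealOfUltrafilter v E U) ∧
    -- the Krull dimension
    (E.Nonempty → ringKrullDim (IntegerValuedPolynomials.intPoly v E) = 2) := by
  have hE : IntegerValuedPolynomials.HasPseudoConvergentSubseq v E := fun x hxE hx =>
    IntegerValuedPolynomials.exists_pseudoConvergent_subseq hx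
      (fun φ h => hdiv ⟨x ∘ φ, fun n => hxE (φ n), h⟩)
      (fun φ h => hstat ⟨x ∘ φ, fun n => hxE (φ n), h⟩)
  refine ⟨fun P hP => IntegerValuedPolynomials.eq_bot_or_eq_maximalIdeal v _ (hP.under _),
    IntegerValuedPolynomials.bijOn_idealOfPoly v E,
    fun P hP hPm => ⟨hE.isMaximal hP hPm, ⟨hE.quotientEquiv hP hPm⟩⟩,
    fun P => ⟨fun h => hE.exists_eq_idealOfUltrafilter h.1 h.2, ?_⟩,
    fun hne => le_antisymm hE.ringKrullDim_le
      (IntegerValuedPolynomials.two_le_ringKrullDim hne)⟩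
  rintro ⟨U, rfl⟩
  exact ⟨IntegerValuedPolynomials.isPrime_idealOfUltrafilter U,
    IntegerValuedPolynomials.under_idealOfUltrafilter U⟩
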